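/- **Lemma.** Let $M$ be a smooth (Hausdorff, finite-dimensional, boundaryless) manifold with a symplectic form $\omega$ (a smooth, closed, nondegenerate $2$-form), let $H\colon M\to\mathbb{R}$ be smooth, and let $X_H$ be the Hamiltonian vector field, determined by $\omega(v,X_H)=\mathrm{d}H(v)$ for all tangent vectors $v$. Let $L\subseteq M$ be a connected Lagrangian submanifold, i.e. a connected (smoothly) embedded submanifold such that each tangent space $T_pL$ equals its own $\omega$-orthogonal complement in $T_pM$. Then: 1. $L$ is locally invariant under the flow of $X_H$ (whenever an integral curve $\gamma$ of $X_H$ satisfies $\gamma(t_0)\in L$, one has $\gamma(t)\in L$ for all $t$ sufficiently close to $t_0$) if and only if $L$ is contained in a level set $H^{-1}(c)$, $c\in\mathbb{R}$. 2. If moreover $L$ is a closed subset of $M$, then $L$ is invariant under the flow of $X_H$ (every integral curve of $X_H$ on an open interval which meets $L$ lies entirely in $L$) if and only if $L$ is contained in a level set $H^{-1}(c)$, $c\in\mathbb{R}$. -/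

import Mathlib

open Set Filter Topology Manifold
open scoped ContDiff

noncomputable section

namespace HamiltonianSystem

section Forms

variable {E : Type*} [NormedAddCommGroup E] [NormedSpace ℝ E]
  {M : Type*} [TopologicalSpace M] [ChartedSpace E M]

/-- The expression of a 2-form `Ω` on `M` in the preferred chart `φ` at `x₀`: the pullback
of `Ω` under `φ⁻¹`, a 2-form on the open set `φ.target` of `E` (its values off `φ.target`
have no meaning and are never used). -/
def formInChart (Ω : (x : M) → (TangentSpace 𝓘(ℝ, E) x) [⋀^Fin 2]→L[ℝ] ℝ) (x₀ : M) (y : E) :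
    E [⋀^Fin 2]→L[ℝ] ℝ :=
  (Ω ((chartAt E x₀).symm y)).compContinuousLinearMap
    (mfderiv 𝓘(ℝ, E) 𝓘(ℝ, E) (chartAt E x₀).symm y)

variable (E M) in
/-- A symplectic form on `M`: a smooth, closed, nondegenerate 2-form. Smoothness and closedness
are those of the expressions of the form in the charts of the atlas. -/
structure SymplecticForm where
  /-- The value of the form at a point. -/
  form : (x : M) → (TangentSpace 𝓘(ℝ, E) x) [⋀^Fin 2]→L[ℝ] ℝ
  smooth : ∀ x₀ : M, ContDiffOn ℝ ∞ (formInChart form x₀) (chartAt E x₀).target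
  closed : ∀ x₀ : M, ∀ y ∈ (chartAt E x₀).target, extDeriv (formInChart form x₀) y = 0
  nondegenerate : ∀ (x : M) (v : TangentSpace 𝓘(ℝ, E) x),
    (∀ w : TangentSpace 𝓘(ℝ, E) x, form x ![w, v] = 0) → v = 0

/-- By nondegeneracy, every covector `α` at `x` is `Ω(·, X)` for some tangent vector `X`. -/
theorem SymplecticForm.exists_vector [FiniteDimensional ℝ E] (Ω : SymplecticForm E M) (x : M)
    (α : TangentSpace 𝓘(ℝ, E) x →L[ℝ] ℝ) :
    ∃ X : TangentSpace 𝓘(ℝ, E) x, ∀ v : TangentSpace 𝓘(ℝ, E) x, Ω.form x ![v, X] = α v := by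
  have : FiniteDimensional ℝ (TangentSpace 𝓘(ℝ, E) x) := inferInstanceAs (FiniteDimensional ℝ E)
  have e₀ : ∀ v X Y : TangentSpace 𝓘(ℝ, E) x, Function.update ![v, X] 0 Y = ![Y, X] := by
    intro v X Y; ext i; fin_cases i <;> rfl
  have e₁ : ∀ v X Y : TangentSpace 𝓘(ℝ, E) x, Function.update ![v, X] 1 Y = ![v, Y] := by
    intro v X Y; ext i; fin_cases i <;> rfl
  let flat : TangentSpace 𝓘(ℝ, E) x →ₗ[ℝ] Module.Dual ℝ (TangentSpace 𝓘(ℝ, E) x) :=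
    LinearMap.mk₂ ℝ (fun X v => Ω.form x ![v, X])
      (fun X X' v => by simpa only [e₁] using (Ω.form x).map_update_add ![v, X] 1 X X')
      (fun c X v => by simpa only [e₁] using (Ω.form x).map_update_smul ![v, X] 1 c X)
      (fun X v v' => by simpa only [e₀] using (Ω.form x).map_update_add ![v, X] 0 v v')
      (fun c X v => by simpa only [e₀] using (Ω.form x).map_update_smul ![v, X] 0 c v)
  have hinj : Function.Injective flat := by
    rw [injective_iff_map_eq_zero]
    exact fun X hX => Ω.nondegenerate x X fun w => DFunLike.congr_fun hX w
  have hsurj : Function.Surjective flat :=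
    (LinearMap.injective_iff_surjective_of_finrank_eq_finrank
      (Subspace.dual_finrank_eq (K := ℝ)).symm).1 hinj
  obtain ⟨X, hX⟩ := hsurj α.toLinearMap
  exact ⟨X, fun v => DFunLike.congr_fun hX v⟩

/-- The Hamiltonian vector field `X_h` of `h`, determined by `Ω(v, X_h) = dh(v)` for all `v`. -/
def hamiltonianVectorField [FiniteDimensional ℝ E] (Ω : SymplecticForm E M) (h : M → ℝ) (x : M) :
    TangentSpace 𝓘(ℝ, E) x :=
  Classical.choose (Ω.exists_vector x (mfderiv 𝓘(ℝ, E) 𝓘(ℝ, ℝ) h x))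

theorem form_hamiltonianVectorField [FiniteDimensional ℝ E] (Ω : SymplecticForm E M) (h : M → ℝ)
    (x : M) (v : TangentSpace 𝓘(ℝ, E) x) :
    Ω.form x ![v, hamiltonianVectorField Ω h x] = mfderiv 𝓘(ℝ, E) 𝓘(ℝ, ℝ) h x v :=
  Classical.choose_spec (Ω.exists_vector x (mfderiv 𝓘(ℝ, E) 𝓘(ℝ, ℝ) h x)) v

/-- `L` is invariant under the (possibly only partially defined) flow of the vector field `X`:
an integral curve of `X` on an open interval that meets `L` stays in `L`. -/
def IsFlowInvariant (X : (x : M) → TangentSpace 𝓘(ℝ, E) x) (L : Set M) : Prop :=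
  ∀ (γ : ℝ → M) (a b : ℝ), IsMIntegralCurveOn γ X (Ioo a b) →
    ∀ t₀ ∈ Ioo a b, γ t₀ ∈ L → ∀ t ∈ Ioo a b, γ t ∈ L

/-- `L` is locally invariant under the flow of `X`: an integral curve of `X` that is in `L` at
time `t₀` is in `L` at all times near `t₀`. -/
def IsLocallyFlowInvariant (X : (x : M) → TangentSpace 𝓘(ℝ, E) x) (L : Set M) : Prop :=
  ∀ (γ : ℝ → M) (t₀ : ℝ), IsMIntegralCurveAt γ X t₀ → γ t₀ ∈ L → ∀ᶠ t in 𝓝 t₀, γ t ∈ L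

/-- A subset `L` of `M`, with the subspace topology and a smooth structure modelled on `F`, is
a Lagrangian submanifold of `(M, Ω)`: the inclusion is a smooth embedding, and each tangent space
of `L` (the image of the derivative of the inclusion) is its own `Ω`-orthogonal complement. -/
structure IsLagrangianSubmanifold {F : Type*} [NormedAddCommGroup F] [NormedSpace ℝ F]
    (Ω : SymplecticForm E M) (L : Set M) [ChartedSpace F L] : Prop where
  isManifold : IsManifold 𝓘(ℝ, F) ∞ L
  isSmoothEmbedding : IsSmoothEmbedding 𝓘(ℝ, F) 𝓘(ℝ, E) ∞ (Subtype.val : L → M)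
  lagrangian : ∀ (p : L) (w : TangentSpace 𝓘(ℝ, E) (p : M)),
    w ∈ range (mfderiv 𝓘(ℝ, F) 𝓘(ℝ, E) (Subtype.val : L → M) p) ↔
      ∀ u : TangentSpace 𝓘(ℝ, F) p,
        Ω.form p ![mfderiv 𝓘(ℝ, F) 𝓘(ℝ, E) (Subtype.val : L → M) p u, w] = 0

end Forms

end HamiltonianSystem

end

/-!
Locally, a submanifold is the zero set of the transversal component `y` of a slice chart. If a `C^1`
vector field `X` is tangent to the submanifold, then `dy(X)` vanishes where `y` does, so it is
bounded by a multiple of `‖y‖`, and Grönwall's inequality keeps `y = 0` along an integral curve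
starting at `y = 0`. Hence local invariance under the flow of `X` is tangency of `X`. For closed
submanifolds it is the same as invariance, since an interval is connected.

On a Lagrangian submanifold `L`, the equation `Ω(u, X_h) = dh(u)` for `u` tangent to `L` says that
`X_h` is `Ω`-orthogonal to `L`, i.e. tangent to `L`, if and only if `d(h|_L) = 0`.
-/

namespace HamiltonianSystem

section ODE

variable {G : Type*} [NormedAddCommGroup G] [NormedSpace ℝ G]

theorem eventually_nhdsGE_eq_zero_of_norm_deriv_le {y y' : ℝ → G} {K t₀ : ℝ}
    (hy : ∀ᶠ t in 𝓝 t₀, HasDerivAt y (y' t) t) (hy' : ∀ᶠ t in 𝓝 t₀, ‖y' t‖ ≤ K * ‖y t‖)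
    (h₀ : y t₀ = 0) : ∀ᶠ t in 𝓝[≥] t₀, y t = 0 := by
  obtain ⟨b, hb, hIcc⟩ := mem_nhdsGE_iff_exists_Icc_subset.1 (mem_nhdsWithin_of_mem_nhds
    (hy.and hy'))
  filter_upwards [Icc_mem_nhdsGE hb]
  exact eq_zero_of_abs_deriv_le_mul_abs_self_of_eq_zero_right
    (fun t ht => (hIcc ht).1.continuousAt.continuousWithinAt)
    (fun t ht => (hIcc (Ico_subset_Icc_self ht)).1.hasDerivWithinAt) h₀
    fun t ht => (hIcc (Ico_subset_Icc_self ht)).2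

theorem eventually_eq_zero_of_norm_deriv_le {y y' : ℝ → G} {K t₀ : ℝ}
    (hy : ∀ᶠ t in 𝓝 t₀, HasDerivAt y (y' t) t) (hy' : ∀ᶠ t in 𝓝 t₀, ‖y' t‖ ≤ K * ‖y t‖)
    (h₀ : y t₀ = 0) : ∀ᶠ t in 𝓝 t₀, y t = 0 := by
  have hneg : Tendsto Neg.neg (𝓝 (-t₀)) (𝓝 t₀) := by simpa using tendsto_neg (-t₀)
  have hreflected : ∀ᶠ t in 𝓝[≥] (-t₀), y (-t) = 0 :=
    eventually_nhdsGE_eq_zero_of_norm_deriv_le (y' := fun t => -y' (-t))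
      ((hneg.eventually hy).mono fun t ht => by
        simpa [Function.comp_def] using ht.scomp t (hasDerivAt_neg t))
      ((hneg.eventually hy').mono fun t ht => by simpa using ht) (by simpa using h₀)
  rw [← nhdsLE_sup_nhdsGE, eventually_sup]
  refine ⟨?_, eventually_nhdsGE_eq_zero_of_norm_deriv_le hy hy' h₀⟩
  simpa using (tendsto_neg_nhdsLE (a := t₀)).eventually hreflected

end ODE

theorem exists_eventually_norm_le_mul_norm_snd {F G H : Type*} [NormedAddCommGroup F]
    [NormedSpace ℝ F] [NormedAddCommGroup G] [NormedSpace ℝ G] [NormedAddCommGroup H]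
    [NormedSpace ℝ H] {R : F × G → H} {u₀ : F} (hR : ContDiffAt ℝ 1 R (u₀, 0))
    (hR₀ : ∀ᶠ u in 𝓝 u₀, R (u, 0) = 0) :
    ∃ K : ℝ, ∀ᶠ z in 𝓝 (u₀, 0), ‖R z‖ ≤ K * ‖z.2‖ := by
  obtain ⟨K, T, hT, hlip⟩ := hR.exists_lipschitzOnWith
  have hproj : Tendsto (fun z : F × G => (z.1, (0 : G))) (𝓝 (u₀, 0)) (𝓝 (u₀, 0)) :=
    (continuous_fst.prodMk continuous_const).tendsto (u₀, (0 : G))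
  refine ⟨K, ?_⟩
  filter_upwards [hT, hproj hT, (continuous_fst.tendsto (u₀, (0 : G))).eventually hR₀]
    with z hz hz₀ hRz
  simpa [hRz, dist_eq_norm, Prod.norm_def] using hlip.dist_le_mul z hz (z.1, 0) hz₀

theorem exists_forall_eq_of_mfderiv_eq_zero {F V N : Type*} [NormedAddCommGroup F]
    [NormedSpace ℝ F] [NormedAddCommGroup V] [NormedSpace ℝ V]
    [TopologicalSpace N] [ChartedSpace F N] [IsManifold 𝓘(ℝ, F) 1 N] [PreconnectedSpace N]
    {f : N → V} (hf : MDifferentiable 𝓘(ℝ, F) 𝓘(ℝ, V) f)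
    (hf' : ∀ q, mfderiv 𝓘(ℝ, F) 𝓘(ℝ, V) f q = 0) : ∃ c, ∀ q, f q = c := by
  have hloc : IsLocallyConstant f := fun t => isOpen_iff_mem_nhds.2 fun p hp => by
    set φ := chartAt F p
    have hφ : φ.MDifferentiable 𝓘(ℝ, F) 𝓘(ℝ, F) := mdifferentiable_chart p
    have hderiv : ∀ y ∈ φ.target, HasFDerivAt (f ∘ φ.symm) (0 : F →L[ℝ] V) y := fun y hy => by
      have hcomp := (hf (φ.symm y)).hasMFDerivAt.comp y (hφ.symm.mdifferentiableAt hy).hasMFDerivAt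
      rw [hf'] at hcomp
      exact (hasMFDerivAt_iff_hasFDerivAt.1 hcomp).congr_fderiv (ContinuousLinearMap.zero_comp _)
    have hopen : IsOpen (φ.target ∩ f ∘ φ.symm ⁻¹' t) :=
      φ.open_target.isOpen_inter_preimage_of_fderiv_eq_zero
        (fun y hy => (hderiv y hy).differentiableAt.differentiableWithinAt)
        (fun y hy => (hderiv y hy).fderiv) t
    have hp' : p ∈ φ.source := mem_chart_source F p
    filter_upwards [(φ.isOpen_inter_preimage hopen).mem_nhds
      ⟨hp', φ.map_source hp', by simpa [φ.left_inv hp'] using hp⟩] with q hq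
    simpa [φ.left_inv hq.1] using hq.2.2
  cases isEmpty_or_nonempty N with
  | inl _ => exact ⟨0, isEmptyElim⟩
  | inr hN => exact hN.elim fun p => ⟨f p, fun q => hloc.apply_eq_of_preconnectedSpace q p⟩

theorem contMDiffOn_mfderiv_apply {𝕜 E V H M : Type*} [NontriviallyNormedField 𝕜]
    [NormedAddCommGroup E] [NormedSpace 𝕜 E] [NormedAddCommGroup V] [NormedSpace 𝕜 V]
    [TopologicalSpace H] {I : ModelWithCorners 𝕜 E H} [TopologicalSpace M] [ChartedSpace H M]
    [IsManifold I 1 M] {m n : ℕ∞ω} {s : Set M} {f : M → V} {X : (x : M) → TangentSpace I x}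
    (hs : IsOpen s) (hf : ContMDiffOn I 𝓘(𝕜, V) n f s) (hX : ContMDiffOn I I.tangent m (T% X) s)
    (hmn : m + 1 ≤ n) :
    ContMDiffOn I 𝓘(𝕜, V) m (fun x => (mfderiv I 𝓘(𝕜, V) f x (X x) : V)) s := by
  have htangentMap := hf.contMDiffOn_tangentMapWithin hmn hs.uniqueMDiffOn
  have hsnd := (contMDiff_snd_tangentBundle_modelSpace V 𝓘(𝕜, V)).comp_contMDiffOn
    (htangentMap.comp hX fun x hx => hx)
  exact hsnd.congr fun x hx => DFunLike.congr_fun (mfderivWithin_of_isOpen hs hx).symm (X x)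

theorem hasDerivAt_comp_of_hasMFDerivAt {E V H M : Type*}
    [NormedAddCommGroup E] [NormedSpace ℝ E] [NormedAddCommGroup V] [NormedSpace ℝ V]
    [TopologicalSpace H] {I : ModelWithCorners ℝ E H} [TopologicalSpace M] [ChartedSpace H M]
    {f : M → V} {γ : ℝ → M} {t : ℝ} {v : TangentSpace I (γ t)}
    (hf : MDifferentiableAt I 𝓘(ℝ, V) f (γ t))
    (hγ : HasMFDerivAt 𝓘(ℝ, ℝ) I γ t ((1 : ℝ →L[ℝ] ℝ).smulRight v)) :
    HasDerivAt (f ∘ γ) (mfderiv I 𝓘(ℝ, V) f (γ t) v) t := by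
  have h : HasFDerivAt (f ∘ γ)
      ((1 : ℝ →L[ℝ] ℝ).smulRight (mfderiv I 𝓘(ℝ, V) f (γ t) v : V)) t :=
    (hasMFDerivAt_iff_hasFDerivAt.1 (hf.hasMFDerivAt.comp t hγ)).congr_fderiv <| by
      ext
      exact (mfderiv I 𝓘(ℝ, V) f (γ t)).map_smul (1 : ℝ) v
  exact h.hasDerivAt.congr_deriv (one_smul ℝ _)

section SliceCharts

universe u

variable {E : Type u} [NormedAddCommGroup E] [NormedSpace ℝ E]
  {M : Type*} [TopologicalSpace M] [ChartedSpace E M]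
  {F : Type*} [NormedAddCommGroup F] [NormedSpace ℝ F]
  {G : Type*} [NormedAddCommGroup G] [NormedSpace ℝ G]
  {L : Set M} [ChartedSpace F L]

variable (E) in
/-- `Φ` is a slice chart of `M` for the submanifold `L`: a smooth chart with values in `F × G` in
which `L` is the slice `F × {0}`, on which `Φ` restricts to the chart `φ` of `L`. -/
structure IsSliceChart (φ : OpenPartialHomeomorph L F) (Φ : OpenPartialHomeomorph M (F × G)) :
    Prop where
  mem_maximalAtlas : φ ∈ IsManifold.maximalAtlas 𝓘(ℝ, F) ∞ L
  contMDiffOn : ContMDiffOn 𝓘(ℝ, E) 𝓘(ℝ, F × G) ∞ Φ Φ.source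
  contMDiffOn_symm : ContMDiffOn 𝓘(ℝ, F × G) 𝓘(ℝ, E) ∞ Φ.symm Φ.target
  coe_mem_source_iff : ∀ q : L, (q : M) ∈ Φ.source ↔ q ∈ φ.source
  apply_coe : ∀ q ∈ φ.source, Φ q = (φ q, 0)
  mem_of_snd_eq_zero : ∀ x ∈ Φ.source, (Φ x).2 = 0 → x ∈ L

theorem codChart_apply_of_isImmersionAt {N : Type*} [TopologicalSpace N] [ChartedSpace F N]
    {f : N → M} {p q : N} (hf : IsImmersionAt 𝓘(ℝ, F) 𝓘(ℝ, E) ∞ f p)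
    (hq : q ∈ hf.domChart.source) : hf.codChart (f q) = hf.equiv (hf.domChart q, 0) := by
  have hmem : hf.domChart q ∈ (hf.domChart.extend 𝓘(ℝ, F)).target := by
    simpa using hf.domChart.map_source hq
  simpa [hf.domChart.left_inv hq] using hf.writtenInCharts hmem

theorem exists_isSliceChart (hL : IsSmoothEmbedding 𝓘(ℝ, F) 𝓘(ℝ, E) ∞ (Subtype.val : L → M))
    (p : L) : ∃ (G : Type u) (_ : NormedAddCommGroup G) (_ : NormedSpace ℝ G)
      (φ : OpenPartialHomeomorph L F) (Φ : OpenPartialHomeomorph M (F × G)),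
      IsSliceChart E φ Φ ∧ p ∈ φ.source := by
  have hp := hL.isImmersion.isImmersionAt p
  set φ := hp.domChart
  set ψ := hp.codChart
  set e := hp.equiv
  let Ψ : OpenPartialHomeomorph M (F × hp.complement) := ψ.transHomeomorph e.symm.toHomeomorph
  have hΨ : ∀ q ∈ φ.source, Ψ q = (φ q, 0) := fun q hq => by
    simp [Ψ, ψ, φ, e, codChart_apply_of_isImmersionAt hp hq]
  have hmaps : ∀ q ∈ φ.source, (q : M) ∈ Ψ.source := hp.source_subset_preimage_source
  obtain ⟨U, hU, hUφ⟩ := isOpen_induced_iff.1 φ.open_source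
  have hV : IsOpen (U ∩ (Ψ.source ∩ Ψ ⁻¹' (Prod.fst ⁻¹' φ.target))) :=
    hU.inter (Ψ.isOpen_inter_preimage (φ.open_target.preimage continuous_fst))
  refine ⟨hp.complement, inferInstance, inferInstance, φ, Ψ.restrOpen _ hV, ?_,
    hp.mem_domChart_source⟩
  refine ⟨hp.domChart_mem_maximalAtlas, ?_, ?_, fun q => ⟨fun hq => ?_, fun hq => ?_⟩, hΨ, ?_⟩
  · exact (e.symm.contDiff.contMDiff.comp_contMDiffOn
      (contMDiffOn_of_mem_maximalAtlas hp.codChart_mem_maximalAtlas)).mono inter_subset_left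
  · exact ((contMDiffOn_symm_of_mem_maximalAtlas hp.codChart_mem_maximalAtlas).comp
      e.contDiff.contMDiff.contMDiffOn fun x hx => hx).mono inter_subset_left
  · rw [← hUφ]
    exact hq.2.1
  · refine ⟨hmaps q hq, ?_, hmaps q hq, ?_⟩
    · rw [← hUφ] at hq
      exact hq
    · simpa [hΨ q hq] using φ.map_source hq
  · rintro x ⟨hx, -, -, hxφ⟩ hx₀
    have hq : φ.symm (Ψ x).1 ∈ φ.source := φ.map_target hxφ
    have hΨq : Ψ (φ.symm (Ψ x).1 : L) = Ψ x := by
      rw [hΨ _ hq, φ.right_inv hxφ]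
      exact Prod.ext rfl hx₀.symm
    rw [← Ψ.injOn (hmaps _ hq) hx hΨq]
    exact Subtype.coe_prop _

namespace IsSliceChart

variable {φ : OpenPartialHomeomorph L F} {Φ : OpenPartialHomeomorph M (F × G)}

theorem mdifferentiable (hΦ : IsSliceChart E φ Φ) : Φ.MDifferentiable 𝓘(ℝ, E) 𝓘(ℝ, F × G) :=
  ⟨hΦ.contMDiffOn.mdifferentiableOn (by simp), hΦ.contMDiffOn_symm.mdifferentiableOn (by simp)⟩

theorem mdifferentiable_restrict (hΦ : IsSliceChart E φ Φ) :
    φ.MDifferentiable 𝓘(ℝ, F) 𝓘(ℝ, F) :=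
  ⟨(contMDiffOn_of_mem_maximalAtlas hΦ.mem_maximalAtlas).mdifferentiableOn (by simp),
    (contMDiffOn_symm_of_mem_maximalAtlas hΦ.mem_maximalAtlas).mdifferentiableOn (by simp)⟩

theorem mem_iff (hΦ : IsSliceChart E φ Φ) {x : M} (hx : x ∈ Φ.source) :
    x ∈ L ↔ (Φ x).2 = 0 :=
  ⟨fun hxL => congrArg Prod.snd
    (hΦ.apply_coe ⟨x, hxL⟩ ((hΦ.coe_mem_source_iff ⟨x, hxL⟩).1 hx)), hΦ.mem_of_snd_eq_zero x hx⟩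

theorem mk_zero_mem_target (hΦ : IsSliceChart E φ Φ) {u : F} (hu : u ∈ φ.target) :
    (u, 0) ∈ Φ.target := by
  have hq := φ.map_target hu
  have h := Φ.map_source ((hΦ.coe_mem_source_iff _).2 hq)
  rwa [hΦ.apply_coe _ hq, φ.right_inv hu] at h

theorem symm_apply_mk_zero (hΦ : IsSliceChart E φ Φ) {u : F} (hu : u ∈ φ.target) :
    Φ.symm (u, 0) = φ.symm u := by
  have hq := φ.map_target hu
  rw [← Φ.left_inv ((hΦ.coe_mem_source_iff _).2 hq), hΦ.apply_coe _ hq, φ.right_inv hu]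

theorem mdifferentiableAt_coe (hΦ : IsSliceChart E φ Φ) {q : L} (hq : q ∈ φ.source) :
    MDifferentiableAt 𝓘(ℝ, F) 𝓘(ℝ, E) (Subtype.val : L → M) q := by
  have hφq := φ.map_source hq
  have hincl : MDifferentiableAt 𝓘(ℝ, F) 𝓘(ℝ, F × G) (fun u : F => (u, (0 : G))) (φ q) :=
    (differentiableAt_id.prodMk (differentiableAt_const _)).mdifferentiableAt
  refine (((hΦ.mdifferentiable.symm.mdifferentiableAt (hΦ.mk_zero_mem_target hφq)).comp
    (φ q) hincl).comp q (hΦ.mdifferentiable_restrict.mdifferentiableAt hq)).congr_of_eventuallyEq ?_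
  filter_upwards [φ.open_source.mem_nhds hq] with z hz
  simp [hΦ.symm_apply_mk_zero (φ.map_source hz), φ.left_inv hz]

theorem mfderiv_mfderiv_coe (hΦ : IsSliceChart E φ Φ) {q : L} (hq : q ∈ φ.source)
    (v : TangentSpace 𝓘(ℝ, F) q) :
    (mfderiv 𝓘(ℝ, E) 𝓘(ℝ, F × G) Φ q
      (mfderiv 𝓘(ℝ, F) 𝓘(ℝ, E) (Subtype.val : L → M) q v) : F × G) =
      ((mfderiv 𝓘(ℝ, F) 𝓘(ℝ, F) φ q v : F), 0) := by
  let ι : F →L[ℝ] F × G := ContinuousLinearMap.inl ℝ F G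
  have heq : Φ ∘ (Subtype.val : L → M) =ᶠ[𝓝 q] ι ∘ φ := by
    filter_upwards [φ.open_source.mem_nhds hq] with z hz using hΦ.apply_coe z hz
  have hchain : (mfderiv 𝓘(ℝ, E) 𝓘(ℝ, F × G) Φ q).comp
      (mfderiv 𝓘(ℝ, F) 𝓘(ℝ, E) (Subtype.val : L → M) q) =
      (mfderiv 𝓘(ℝ, F) 𝓘(ℝ, F × G) ι (φ q)).comp (mfderiv 𝓘(ℝ, F) 𝓘(ℝ, F) φ q) := by
    rw [← mfderiv_comp q (hΦ.mdifferentiable.mdifferentiableAt ((hΦ.coe_mem_source_iff q).2 hq))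
      (hΦ.mdifferentiableAt_coe hq), heq.mfderiv_eq, mfderiv_comp q
      ι.differentiableAt.mdifferentiableAt (hΦ.mdifferentiable_restrict.mdifferentiableAt hq)]
  rw [mfderiv_eq_fderiv, ι.fderiv] at hchain
  exact DFunLike.congr_fun hchain v

theorem mem_range_mfderiv_coe_iff (hΦ : IsSliceChart E φ Φ) {q : L} (hq : q ∈ φ.source)
    (w : TangentSpace 𝓘(ℝ, E) (q : M)) :
    w ∈ range (mfderiv 𝓘(ℝ, F) 𝓘(ℝ, E) (Subtype.val : L → M) q) ↔
      (mfderiv 𝓘(ℝ, E) 𝓘(ℝ, F × G) Φ q w : F × G).2 = 0 := by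
  constructor
  · rintro ⟨v, rfl⟩
    exact congrArg Prod.snd (hΦ.mfderiv_mfderiv_coe hq v)
  · intro hw
    obtain ⟨v, hv⟩ := hΦ.mdifferentiable_restrict.mfderiv_surjective hq
      (mfderiv 𝓘(ℝ, E) 𝓘(ℝ, F × G) Φ q w : F × G).1
    refine ⟨v, hΦ.mdifferentiable.mfderiv_injective ((hΦ.coe_mem_source_iff q).2 hq) ?_⟩
    exact (hΦ.mfderiv_mfderiv_coe hq v).trans (Prod.ext hv hw.symm)

end IsSliceChart

end SliceCharts

section Invariance

universe u

variable {E : Type u} [NormedAddCommGroup E] [NormedSpace ℝ E]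
  {M : Type*} [TopologicalSpace M] [ChartedSpace E M]
  {F : Type*} [NormedAddCommGroup F] [NormedSpace ℝ F]
  {X : (x : M) → TangentSpace 𝓘(ℝ, E) x} {L : Set M}

theorem IsFlowInvariant.isLocallyFlowInvariant (hinv : IsFlowInvariant X L) :
    IsLocallyFlowInvariant X L := by
  intro γ t₀ hγ h₀
  obtain ⟨ε, hε, hball⟩ := isMIntegralCurveAt_iff'.1 hγ
  filter_upwards [Metric.ball_mem_nhds t₀ hε] with t ht
  rw [Real.ball_eq_Ioo] at hball ht
  exact hinv γ _ _ hball t₀ ⟨by linarith, by linarith⟩ h₀ t ht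

theorem IsLocallyFlowInvariant.isFlowInvariant (hinv : IsLocallyFlowInvariant X L)
    (hL : IsClosed L) : IsFlowInvariant X L := by
  intro γ a b hγ t₀ ht₀ h₀ t ht
  let c : Ioo a b → M := (Ioo a b).domRestrict γ
  have hclosed : IsClosed (c ⁻¹' L) := hL.preimage hγ.continuousOn.domRestrict
  have hopen : IsOpen (c ⁻¹' L) := isOpen_iff_mem_nhds.2 fun s hs =>
    continuous_subtype_val.continuousAt.eventually
      (hinv γ s (hγ.isMIntegralCurveAt (Ioo_mem_nhds s.2.1 s.2.2)) hs)
  have : PreconnectedSpace (Ioo a b) := Subtype.preconnectedSpace isPreconnected_Ioo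
  have huniv : c ⁻¹' L = univ := IsClopen.eq_univ ⟨hclosed, hopen⟩ ⟨⟨t₀, ht₀⟩, h₀⟩
  exact (huniv ▸ mem_univ _ : (⟨t, ht⟩ : Ioo a b) ∈ c ⁻¹' L)

variable [ChartedSpace F L]

variable (F X L) in
/-- The vector field `X` on `M` is tangent to the submanifold `L` modelled on `F`: at each point
of `L` its value lies in the tangent space of `L`, the image of the derivative of the inclusion. -/
def IsTangentTo : Prop :=
  ∀ p : L, X p ∈ range (mfderiv 𝓘(ℝ, F) 𝓘(ℝ, E) (Subtype.val : L → M) p)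

variable {G : Type*} [NormedAddCommGroup G] [NormedSpace ℝ G]
  {φ : OpenPartialHomeomorph L F} {Φ : OpenPartialHomeomorph M (F × G)}

theorem IsSliceChart.exists_eventually_norm_snd_mfderiv_le [IsManifold 𝓘(ℝ, E) 1 M]
    (hΦ : IsSliceChart E φ Φ) (hX : CMDiff 1 (T% X)) (htan : IsTangentTo F X L) {p : L}
    (hp : p ∈ φ.source) :
    ∃ K : ℝ, ∀ᶠ x in 𝓝 (p : M),
      ‖(mfderiv 𝓘(ℝ, E) 𝓘(ℝ, F × G) Φ x (X x) : F × G).2‖ ≤ K * ‖(Φ x).2‖ := by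
  have hpΦ : (p : M) ∈ Φ.source := (hΦ.coe_mem_source_iff p).2 hp
  let Z : M → F × G := fun x => mfderiv 𝓘(ℝ, E) 𝓘(ℝ, F × G) Φ x (X x)
  have hZ : ContMDiffOn 𝓘(ℝ, E) 𝓘(ℝ, F × G) 1 Z Φ.source :=
    contMDiffOn_mfderiv_apply Φ.open_source hΦ.contMDiffOn hX.contMDiffOn
      (one_add_one_eq_two.trans_le ENat.LEInfty.out)
  let R : F × G → G := fun z => (Z (Φ.symm z)).2
  have hR : ContDiffAt ℝ 1 R (φ p, 0) := by
    have hmem := hΦ.mk_zero_mem_target (φ.map_source hp)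
    exact (((hZ.comp (hΦ.contMDiffOn_symm.of_le (by simp)) Φ.mapsTo_symm).contMDiffAt
      (Φ.open_target.mem_nhds hmem)).contDiffAt).snd
  have hR₀ : ∀ᶠ u in 𝓝 (φ p), R (u, 0) = 0 := by
    filter_upwards [φ.open_target.mem_nhds (φ.map_source hp)] with u hu
    simp only [R, hΦ.symm_apply_mk_zero hu]
    exact (hΦ.mem_range_mfderiv_coe_iff (φ.map_target hu) _).1 (htan _)
  obtain ⟨K, hK⟩ := exists_eventually_norm_le_mul_norm_snd hR hR₀
  rw [← hΦ.apply_coe p hp] at hK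
  refine ⟨K, ?_⟩
  filter_upwards [(Φ.continuousAt hpΦ).eventually hK, Φ.open_source.mem_nhds hpΦ] with x hx hxΦ
  simpa [R, Φ.left_inv hxΦ] using hx

theorem IsTangentTo.isLocallyFlowInvariant [IsManifold 𝓘(ℝ, E) 1 M] (htan : IsTangentTo F X L)
    (hX : CMDiff 1 (T% X))
    (hL : IsSmoothEmbedding 𝓘(ℝ, F) 𝓘(ℝ, E) ∞ (Subtype.val : L → M)) :
    IsLocallyFlowInvariant X L := by
  intro γ t₀ hγ hγ₀
  obtain ⟨G, _, _, φ, Φ, hΦ, hp⟩ := exists_isSliceChart hL ⟨γ t₀, hγ₀⟩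
  have hpΦ : γ t₀ ∈ Φ.source := (hΦ.coe_mem_source_iff _).2 hp
  have hsource : ∀ᶠ t in 𝓝 t₀, γ t ∈ Φ.source :=
    hγ.continuousAt.eventually_mem (Φ.open_source.mem_nhds hpΦ)
  obtain ⟨K, hK⟩ := hΦ.exists_eventually_norm_snd_mfderiv_le hX htan hp
  have hzero : ∀ᶠ t in 𝓝 t₀, (Φ (γ t)).2 = 0 := by
    refine eventually_eq_zero_of_norm_deriv_le (K := K)
      (y' := fun t => (mfderiv 𝓘(ℝ, E) 𝓘(ℝ, F × G) Φ (γ t) (X (γ t)) : F × G).2) ?_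
      (hγ.continuousAt.eventually hK) ((hΦ.mem_iff hpΦ).1 hγ₀)
    filter_upwards [hγ, hsource] with t ht htΦ
    exact (hasDerivAt_comp_of_hasMFDerivAt (hΦ.mdifferentiable.mdifferentiableAt htΦ) ht).snd
  filter_upwards [hzero, hsource] with t ht htΦ using (hΦ.mem_iff htΦ).2 ht

theorem IsLocallyFlowInvariant.isTangentTo [IsManifold 𝓘(ℝ, E) 1 M] [CompleteSpace E]
    (hinv : IsLocallyFlowInvariant X L) (hX : CMDiff 1 (T% X))
    (hL : IsSmoothEmbedding 𝓘(ℝ, F) 𝓘(ℝ, E) ∞ (Subtype.val : L → M)) : IsTangentTo F X L := by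
  intro p
  obtain ⟨G, _, _, φ, Φ, hΦ, hp⟩ := exists_isSliceChart hL p
  obtain ⟨γ, hγ₀, hγ⟩ := exists_isMIntegralCurveAt_of_contMDiffAt_boundaryless 0 (hX p)
  have hpΦ : γ 0 ∈ Φ.source := hγ₀ ▸ (hΦ.coe_mem_source_iff p).2 hp
  have hderiv : HasDerivAt (fun t => (Φ (γ t)).2)
      (mfderiv 𝓘(ℝ, E) 𝓘(ℝ, F × G) Φ (γ 0) (X (γ 0)) : F × G).2 0 :=
    (hasDerivAt_comp_of_hasMFDerivAt (hΦ.mdifferentiable.mdifferentiableAt hpΦ)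
      hγ.self_of_nhds).snd
  have hzero : (fun t => (Φ (γ t)).2) =ᶠ[𝓝 0] fun _ => 0 := by
    filter_upwards [hinv γ 0 hγ (hγ₀ ▸ p.2),
      hγ.continuousAt.eventually_mem (Φ.open_source.mem_nhds hpΦ)] with t htL htΦ
    exact (hΦ.mem_iff htΦ).1 htL
  rw [hΦ.mem_range_mfderiv_coe_iff hp, ← hγ₀]
  exact hderiv.unique ((hasDerivAt_const (0 : ℝ) (0 : G)).congr_of_eventuallyEq hzero)

theorem isLocallyFlowInvariant_iff_isTangentTo [IsManifold 𝓘(ℝ, E) 1 M] [CompleteSpace E]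
    (hX : CMDiff 1 (T% X))
    (hL : IsSmoothEmbedding 𝓘(ℝ, F) 𝓘(ℝ, E) ∞ (Subtype.val : L → M)) :
    IsLocallyFlowInvariant X L ↔ IsTangentTo F X L :=
  ⟨fun hinv => hinv.isTangentTo hX hL, fun htan => htan.isLocallyFlowInvariant hX hL⟩

end Invariance

section Hamiltonian

variable {E : Type*} [NormedAddCommGroup E] [NormedSpace ℝ E]

variable (E) in
/-- The map `X ↦ η(·, X)` from vectors to covectors defined by a 2-form `η`, as a continuous linear
function of `η`. -/
noncomputable def flat : (E [⋀^Fin 2]→L[ℝ] ℝ) →L[ℝ] E →L[ℝ] E →L[ℝ] ℝ :=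
  (ContinuousLinearMap.flipₗᵢ ℝ E E ℝ).toContinuousLinearEquiv.toContinuousLinearMap ∘L
    ContinuousLinearMap.compL ℝ E (E [⋀^Fin 1]→L[ℝ] ℝ) (E →L[ℝ] ℝ)
      (ContinuousAlternatingMap.ofSubsingletonLIE (𝕜 := ℝ) (E := E) (F := ℝ)
        (0 : Fin 1)).symm.toContinuousLinearEquiv.toContinuousLinearMap ∘L
    (ContinuousAlternatingMap.curryLeftLI (𝕜 := ℝ) (E := E) (F := ℝ) (n := 1)).toContinuousLinearMap

theorem flat_apply (η : E [⋀^Fin 2]→L[ℝ] ℝ) (X v : E) : flat E η X v = η ![v, X] := by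
  change η (Matrix.vecCons v fun _ => X) = η ![v, X]
  congr
  exact funext fun i => by rw [Subsingleton.elim i 0]; rfl

theorem flat_injective {η : E [⋀^Fin 2]→L[ℝ] ℝ} (hη : ∀ v, (∀ w, η ![w, v] = 0) → v = 0) :
    Function.Injective (flat E η) := by
  refine (injective_iff_map_eq_zero _).2 fun X hX => hη X fun w => ?_
  rw [← flat_apply, hX, zero_apply]

theorem isInvertible_flat [FiniteDimensional ℝ E] {η : E [⋀^Fin 2]→L[ℝ] ℝ}
    (hη : ∀ v, (∀ w, η ![w, v] = 0) → v = 0) : (flat E η).IsInvertible := by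
  have hdim : Module.finrank ℝ E = Module.finrank ℝ (E →L[ℝ] ℝ) := by
    rw [← (LinearMap.toContinuousLinearMap (𝕜 := ℝ) (E := E) (F' := ℝ)).finrank_eq]
    exact (Subspace.dual_finrank_eq (K := ℝ)).symm
  exact ⟨(LinearEquiv.ofInjectiveOfFinrankEq (flat E η : E →ₗ[ℝ] E →L[ℝ] ℝ)
    (flat_injective hη) hdim).toContinuousLinearEquiv, rfl⟩

variable {M : Type*} [TopologicalSpace M] [ChartedSpace E M]

theorem formInChart_apply (Ω : (x : M) → (TangentSpace 𝓘(ℝ, E) x) [⋀^Fin 2]→L[ℝ] ℝ) (x₀ : M)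
    (y v w : E) :
    formInChart Ω x₀ y ![v, w] = Ω ((chartAt E x₀).symm y)
      ![mfderiv 𝓘(ℝ, E) 𝓘(ℝ, E) (chartAt E x₀).symm y v,
        mfderiv 𝓘(ℝ, E) 𝓘(ℝ, E) (chartAt E x₀).symm y w] := by
  change Ω _ _ = Ω _ _
  congr
  ext i
  fin_cases i <;> rfl

theorem eq_hamiltonianVectorField [FiniteDimensional ℝ E] (Ω : SymplecticForm E M) {h : M → ℝ}
    {x : M} {X : TangentSpace 𝓘(ℝ, E) x}
    (hX : ∀ v, Ω.form x ![v, X] = mfderiv 𝓘(ℝ, E) 𝓘(ℝ, ℝ) h x v) :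
    X = hamiltonianVectorField Ω h x := by
  let η : E [⋀^Fin 2]→L[ℝ] ℝ := Ω.form x
  refine flat_injective (η := η) (Ω.nondegenerate x) (ContinuousLinearMap.ext fun v => ?_)
  exact (flat_apply η X v).trans <| (hX v).trans <|
    (form_hamiltonianVectorField Ω h x v).symm.trans (flat_apply η _ v).symm

section Chart

variable [FiniteDimensional ℝ E] (Ω : SymplecticForm E M) (h : M → ℝ) (x₀ : M)

/-- The expression of the Hamiltonian vector field of `h` in the preferred chart at `x₀`, obtained
by inverting the matrix of `Ω` there (its values off the target of the chart have no meaning). -/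
noncomputable def hamiltonianVectorFieldInChart (y : E) : TangentSpace 𝓘(ℝ, E) y :=
  (flat E (formInChart Ω.form x₀ y)).inverse (fderiv ℝ (h ∘ (chartAt E x₀).symm) y)

variable [IsManifold 𝓘(ℝ, E) ∞ M]

theorem isInvertible_flat_formInChart {y : E} (hy : y ∈ (chartAt E x₀).target) :
    (flat E (formInChart Ω.form x₀ y)).IsInvertible := by
  have hsymm := (mdifferentiable_chart (I := 𝓘(ℝ, E)) x₀).symm
  refine isInvertible_flat fun v hv => hsymm.mfderiv_injective hy ?_
  refine (Ω.nondegenerate _ _ fun w => ?_).trans (map_zero _).symm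
  obtain ⟨u, rfl⟩ := hsymm.mfderiv_surjective hy w
  exact (formInChart_apply Ω.form x₀ y u v).symm.trans (hv u)

variable {h}

theorem mfderiv_chartAt_symm_hamiltonianVectorFieldInChart
    (hh : MDifferentiable 𝓘(ℝ, E) 𝓘(ℝ, ℝ) h) {y : E} (hy : y ∈ (chartAt E x₀).target) :
    mfderiv 𝓘(ℝ, E) 𝓘(ℝ, E) (chartAt E x₀).symm y (hamiltonianVectorFieldInChart Ω h x₀ y) =
      hamiltonianVectorField Ω h ((chartAt E x₀).symm y) := by
  have hsymm := (mdifferentiable_chart (I := 𝓘(ℝ, E)) x₀).symm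
  refine eq_hamiltonianVectorField Ω fun v => ?_
  obtain ⟨u, rfl⟩ := hsymm.mfderiv_surjective hy v
  have hflat : flat E (formInChart Ω.form x₀ y) (hamiltonianVectorFieldInChart Ω h x₀ y) u =
      mfderiv 𝓘(ℝ, E) 𝓘(ℝ, ℝ) (h ∘ (chartAt E x₀).symm) y u := by
    rw [mfderiv_eq_fderiv]
    exact DFunLike.congr_fun ((isInvertible_flat_formInChart Ω x₀ hy).self_apply_inverse _) u
  rw [mfderiv_comp (I' := 𝓘(ℝ, E)) y (hh _) (hsymm.mdifferentiableAt hy)] at hflat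
  exact (formInChart_apply Ω.form x₀ y u _).symm.trans ((flat_apply _ _ _).symm.trans hflat)

theorem contMDiffOn_hamiltonianVectorFieldInChart {m n : ℕ∞ω}
    (hh : ContMDiff 𝓘(ℝ, E) 𝓘(ℝ, ℝ) n h) (hmn : m + 1 ≤ n) (hm : m + 1 ≤ ∞) :
    CMDiff[(chartAt E x₀).target] m (T% (hamiltonianVectorFieldInChart Ω h x₀)) := by
  have hflat : ContDiffOn ℝ m (fun y => flat E (formInChart Ω.form x₀ y)) (chartAt E x₀).target :=
    ContDiff.comp_contDiffOn (g := flat E) (ContinuousLinearMap.contDiff (𝕜 := ℝ)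
      (E := E [⋀^Fin 2]→L[ℝ] ℝ) (F := E →L[ℝ] E →L[ℝ] ℝ) (flat E))
      ((Ω.smooth x₀).of_le (le_self_add.trans hm))
  have hinverse : ContDiffOn ℝ m (fun y => (flat E (formInChart Ω.form x₀ y)).inverse)
      (chartAt E x₀).target := fun y hy =>
    ContDiffAt.comp_contDiffWithinAt (g := ContinuousLinearMap.inverse) y
      (isInvertible_flat_formInChart Ω x₀ hy).contDiffAt_map_inverse (hflat y hy)
  have hlocal : ContDiffOn ℝ (m + 1) (h ∘ (chartAt E x₀).symm) (chartAt E x₀).target :=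
    ((hh.of_le hmn).comp_contMDiffOn ((contMDiffOn_chart_symm (n := ∞)).of_le hm)).contDiffOn
  exact contMDiffOn_vectorSpace_iff_contDiffOn.2 <| hinverse.clm_apply <|
    hlocal.fderiv_of_isOpen (chartAt E x₀).open_target le_rfl

end Chart

theorem contMDiff_hamiltonianVectorField [FiniteDimensional ℝ E] [IsManifold 𝓘(ℝ, E) ∞ M]
    (Ω : SymplecticForm E M) {h : M → ℝ} {m n : ℕ∞ω} (hh : ContMDiff 𝓘(ℝ, E) 𝓘(ℝ, ℝ) n h)
    (hmn : m + 1 ≤ n) (hm : m + 1 ≤ ∞) : CMDiff m (T% (hamiltonianVectorField Ω h)) := by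
  intro x₀
  set ψ := chartAt E x₀
  have htangent : ContMDiffOn 𝓘(ℝ, E).tangent 𝓘(ℝ, E).tangent m
      (tangentMapWithin 𝓘(ℝ, E) 𝓘(ℝ, E) ψ.symm ψ.target) (Bundle.TotalSpace.proj ⁻¹' ψ.target) :=
    (contMDiffOn_chart_symm (n := ∞)).contMDiffOn_tangentMapWithin hm
      ψ.open_target.uniqueMDiffOn
  have hlift := (htangent.comp (contMDiffOn_hamiltonianVectorFieldInChart Ω x₀ hh hmn hm)
    fun y hy => hy).comp ((contMDiffOn_chart (n := ∞)).of_le (le_self_add.trans hm)) ψ.mapsTo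
  have hpush : ∀ y ∈ ψ.target, (⟨ψ.symm y, hamiltonianVectorField Ω h (ψ.symm y)⟩ :
      TangentBundle 𝓘(ℝ, E) M) = tangentMapWithin 𝓘(ℝ, E) 𝓘(ℝ, E) ψ.symm ψ.target
        ⟨y, hamiltonianVectorFieldInChart Ω h x₀ y⟩ := fun y hy => by
    have hhd := hh.mdifferentiable (n := n) (zero_lt_one.trans_le (le_add_self.trans hmn)).ne'
    rw [← mfderiv_chartAt_symm_hamiltonianVectorFieldInChart Ω x₀ hhd hy,
      ← mfderivWithin_of_isOpen ψ.open_target hy]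
    rfl
  refine (hlift.congr fun x hx => ?_).contMDiffAt (ψ.open_source.mem_nhds (mem_chart_source E x₀))
  have hpush_chart := hpush (ψ x) (ψ.map_source hx)
  rwa [ψ.left_inv hx] at hpush_chart

variable {F : Type*} [NormedAddCommGroup F] [NormedSpace ℝ F] [FiniteDimensional ℝ E]

theorem IsLagrangianSubmanifold.isTangentTo_hamiltonianVectorField_iff {Ω : SymplecticForm E M}
    {h : M → ℝ} {L : Set M} [ChartedSpace F L] (hL : IsLagrangianSubmanifold (F := F) Ω L)
    (hh : MDifferentiable 𝓘(ℝ, E) 𝓘(ℝ, ℝ) h) :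
    IsTangentTo F (hamiltonianVectorField Ω h) L ↔
      ∀ p : L, mfderiv 𝓘(ℝ, F) 𝓘(ℝ, ℝ) (h ∘ (Subtype.val : L → M)) p = 0 := by
  have hval : MDifferentiable 𝓘(ℝ, F) 𝓘(ℝ, E) (Subtype.val : L → M) :=
    hL.isSmoothEmbedding.isImmersion.contMDiff.mdifferentiable (by simp)
  refine forall_congr' fun p => ?_
  rw [hL.lagrangian, mfderiv_comp (I' := 𝓘(ℝ, E)) p (hh _) (hval p)]
  simp only [form_hamiltonianVectorField]
  exact ⟨fun hzero => ContinuousLinearMap.ext hzero, fun hzero => DFunLike.congr_fun hzero⟩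

theorem IsLagrangianSubmanifold.isTangentTo_hamiltonianVectorField_iff_exists
    {Ω : SymplecticForm E M} {h : M → ℝ} {L : Set M} [ChartedSpace F L]
    (hL : IsLagrangianSubmanifold (F := F) Ω L) (hh : MDifferentiable 𝓘(ℝ, E) 𝓘(ℝ, ℝ) h)
    (hconn : IsPreconnected L) :
    IsTangentTo F (hamiltonianVectorField Ω h) L ↔ ∃ c : ℝ, L ⊆ h ⁻¹' {c} := by
  have := hL.isManifold
  have : PreconnectedSpace L := Subtype.preconnectedSpace hconn
  rw [hL.isTangentTo_hamiltonianVectorField_iff hh]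
  constructor
  · intro hzero
    obtain ⟨c, hc⟩ := exists_forall_eq_of_mfderiv_eq_zero (hh.comp
      (hL.isSmoothEmbedding.isImmersion.contMDiff.mdifferentiable (by simp))) hzero
    exact ⟨c, fun x hx => hc ⟨x, hx⟩⟩
  · rintro ⟨c, hc⟩ p
    have hconst : h ∘ (Subtype.val : L → M) = fun _ => c := funext fun q => hc q.2
    rw [hconst, mfderiv_const]

end Hamiltonian

end HamiltonianSystem

theorem mainTheorem6_general
    {E : Type*} [NormedAddCommGroup E] [NormedSpace ℝ E] [FiniteDimensional ℝ E]
    {M : Type*} [TopologicalSpace M] [ChartedSpace E M] [IsManifold 𝓘(ℝ, E) ∞ M]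
    (Ω : HamiltonianSystem.SymplecticForm E M)
    (h : M → ℝ) (hh : ContMDiff 𝓘(ℝ, E) 𝓘(ℝ, ℝ) 2 h)
    {F : Type*} [NormedAddCommGroup F] [NormedSpace ℝ F]
    (L : Set M) [ChartedSpace F L]
    (hL : HamiltonianSystem.IsLagrangianSubmanifold (F := F) Ω L)
    (hconn : IsPreconnected L) :
    (HamiltonianSystem.IsLocallyFlowInvariant (HamiltonianSystem.hamiltonianVectorField Ω h) L ↔
      ∃ c : ℝ, L ⊆ h ⁻¹' {c}) ∧
    (IsClosed L →
      (HamiltonianSystem.IsFlowInvariant (HamiltonianSystem.hamiltonianVectorField Ω h) L ↔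
        ∃ c : ℝ, L ⊆ h ⁻¹' {c})) := by
  have : CompleteSpace E := FiniteDimensional.complete ℝ E
  have hX : CMDiff 1 (T% (HamiltonianSystem.hamiltonianVectorField Ω h)) :=
    HamiltonianSystem.contMDiff_hamiltonianVectorField Ω hh one_add_one_eq_two.le
      (one_add_one_eq_two.trans_le ENat.LEInfty.out)
  have hlocal : HamiltonianSystem.IsLocallyFlowInvariant
      (HamiltonianSystem.hamiltonianVectorField Ω h) L ↔ ∃ c : ℝ, L ⊆ h ⁻¹' {c} :=
    (HamiltonianSystem.isLocallyFlowInvariant_iff_isTangentTo hX hL.isSmoothEmbedding).trans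
      (hL.isTangentTo_hamiltonianVectorField_iff_exists (hh.mdifferentiable two_ne_zero) hconn)
  exact ⟨hlocal, fun hclosed => ⟨fun hinv => hlocal.1 hinv.isLocallyFlowInvariant,
    fun hc => (hlocal.2 hc).isFlowInvariant hclosed⟩⟩

theorem mainTheorem6
    {E : Type*} [NormedAddCommGroup E] [NormedSpace ℝ E] [FiniteDimensional ℝ E]
    {M : Type*} [TopologicalSpace M] [T2Space M] [ChartedSpace E M] [IsManifold 𝓘(ℝ, E) ∞ M]
    (Ω : HamiltonianSystem.SymplecticForm E M)
    (h : M → ℝ) (hh : ContMDiff 𝓘(ℝ, E) 𝓘(ℝ, ℝ) ∞ h)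
    {F : Type*} [NormedAddCommGroup F] [NormedSpace ℝ F] [FiniteDimensional ℝ F]
    (L : Set M) [ChartedSpace F L]
    (hL : HamiltonianSystem.IsLagrangianSubmanifold (F := F) Ω L)
    (hconn : IsPreconnected L) :
    (HamiltonianSystem.IsLocallyFlowInvariant (HamiltonianSystem.hamiltonianVectorField Ω h) L ↔
      ∃ c : ℝ, L ⊆ h ⁻¹' {c}) ∧
    (IsClosed L →
      (HamiltonianSystem.IsFlowInvariant (HamiltonianSystem.hamiltonianVectorField Ω h) L ↔
        ∃ c : ℝ, L ⊆ h ⁻¹' {c})) :=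
  mainTheorem6_general Ω h (hh.of_le ENat.LEInfty.out) L hL hconn
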